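/- **Setting.** Let $K$ be a totally ordered set of keys, extended by sentinels $-\infty$ and $\infty$. A *flow graph* consists of a finite set $X$ of addresses (its nodes), fields $\mathtt{mark}$ (Boolean), $\mathtt{next}$ (an address) and $\mathtt{key}$ (an extended key) for each node, and an inflow $in(y,x)$, a set of keys, for each $y\notin X$, $x\in X$. The edge from $x$ to $\mathtt{next}(x)$ carries the function $m\mapsto m\setminus[-\infty,\mathtt{key}(x)]$, or the constant function $m\mapsto(-\infty,\infty]$ if $\mathtt{key}(x)=-\infty$; all other edges carry the constant function $\emptyset$. The flow is the least solution of $flow(x)=\bigcup_{y\notin X}in(y,x)\cup\bigcup_{y\in X}E_{(y,x)}(flow(y))$, and $out(x,y)=E_{(x,y)}(flow(x))$ for $x\in X$, $y\notin X$. Two flow graphs compose, to their union (with the inflow received from each other removed), if their nodes are disjoint, the outflow of each to the other equals the inflow that the other expects from it, and the flow of the union restricts to the flows of the two. A global (local) state is a flow graph with a valuation of the global (local) program variables, one of the global ones being $\mathtt{head}$; composition composes the flow graphs and requires equal valuations. A state is a pair of a global and a local state whose flow graphs compose and where no global variable and no field of a global node points to a local node. States compose component-wise, provided that the result is a state. $p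 * q$ is the set of compositions of a state in $p$ with a state in $q$; formulas without resources hold only of states with empty heaps. **The invariant.** Let $mark_x,next_x,key_x,flow_x,in_x$ be logical variables for each address $x$. Let $\mathsf N(x)$ say that the local heap is empty and that the global flow graph has the single node $x$, with these values as fields, flow and inflow. Put $inset(x)=[-\infty,\infty]$ if $x=\mathtt{head}$ and $inset(x)=flow_x$ otherwise, $\mathcal C(x)=\emptyset$ if $mark_x$ and $\mathcal C(x)=\{key_x\}$ otherwise, $\mathcal C(M)=\bigcup_{x\in M}\mathcal C(x)$. For finite sets $N',N$ of addresses, $\mathsf{Inv}(C,N',N)$ is the separating conjunction of $C=\mathcal C(N')$, of the condition that $\mathtt{head}\in N$, $key_{\mathtt{head}}=-\infty$ and $\neg mark_{\mathtt{head}}$, and, for each $x\in N'$, of $\mathsf N(x)$ and the conditions 1. $\neg mark_x\Rightarrow inset(x)\ne\emptyset$; 2. $inset(x)\neq\emptyset\Rightarrow[key_x,\infty)\subseteq inset(x)$; 3. $x,next_x\in N$, and $key_x=\infty\Rightarrow\neg mark_x$; 4. for all $y,z$: if $in_x(y,x)\neq\emptyset$ and $in_x(z,x)\neq\emptyset$,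 then $y=z$. **Lemma.** Let $\mathsf{Inv}$ be read either under an arbitrary fixed valuation of the logical variables or with the logical variables existentially closed. Let $N'_1,N'_2$ be disjoint finite sets of addresses, $N$ a finite set of addresses, and $s$ a state. Consider the decomposability statement $$(\ast)\qquad s\in\mathsf{Inv}(C,N'_1\uplus N'_2,N)\iff \exists C_1,C_2.\; C=C_1\uplus C_2\ \wedge\ s\in\mathsf{Inv}(C_1,N'_1,N) * \mathsf{Inv}(C_2,N'_2,N),$$ where $C_1\uplus C_2$ is the union of disjoint sets. (a) If in $s$ the contents of $N'_1$ and $N'_2$ (the sets of keys of their unmarked nodes in the global heap) are disjoint, then $(\ast)$ holds for all $C$. (b) If $s$ is part of a complete Harris set structure with nodes $N$, that is, $s$ composes with some state to a state $t$ that satisfies $\mathsf{Inv}(C_0,N,N)$ (with its logical variables existentially closed) for some $C_0$, in which there is no inflow from outside of $N$ and only the head node has key $-\infty$, then $(\ast)$ holds for all $C$, with no assumption on the contents. (c) For every state $s$ and every $C$: $s\in\mathsf{Inv}(C,N'_1\uplus N'_2,N)$ if and only if there are $C_1,C_2$, not necessarily disjoint, with $C=C_1\cup C_2$ and $s\in\mathsf{Inv}(C_1,N'_1,N)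 * \mathsf{Inv}(C_2,N'_2,N)$. In particular, the direction from right to left of $(\ast)$ always holds. -/

import Mathlib

namespace HarrisSet

/-- Keys together with the two sentinel keys `⊥ = -∞` and `⊤ = ∞`. -/
abbrev EKey (K : Type*) := WithBot (WithTop K)

/-- The physical fields of a list node. -/
structure Cell (Addr K : Type*) where
  mark : Bool
  next : Addr
  key : EKey K

/-- Values of program variables. -/
inductive Val (Addr K : Type*) where
  | addr (a : Addr)
  | key (k : EKey K)
  | bool (b : Bool)

section FlowGraphs

variable {Addr K : Type*} [LinearOrder K]

/-- The edge function of the edge from a node with fields `c` to the address `y`, applied to the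
flow value `m`. It is the constant `∅` unless `y` is the `next` pointer; otherwise it is
`m ↦ (-∞, ∞]` if the key is `-∞`, and `m ↦ m \ [-∞, key]` if not. -/
def Cell.edge (c : Cell Addr K) (y : Addr) (m : Set (EKey K)) : Set (EKey K) :=
  {k | c.next = y ∧ ((c.key = ⊥ ∧ k ∈ Set.Ioi (⊥ : EKey K)) ∨
    (c.key ≠ ⊥ ∧ k ∈ m \ Set.Iic c.key))}

/-- A flow graph for the flow monoid (sets of keys, `∪`, `∅`): a finite heap graph and an inflow.
The nodes are the addresses whose cell is not `none`. The edges of the flow constraint are induced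
by the cells through `Cell.edge`. The inflow is a function on (outside) × (inside); outside of
this domain it is normalised to `∅`, so that equality of flow graphs is the intended one. -/
@[ext]
structure FlowGraph (Addr K : Type*) where
  cell : Addr → Option (Cell Addr K)
  inflow : Addr → Addr → Set (EKey K)
  finite_nodes : {a | cell a ≠ none}.Finite
  inflow_dom : ∀ y x, (cell y ≠ none ∨ cell x = none) → inflow y x = ∅

namespace FlowGraph

/-- The set of nodes of a flow graph. -/
def nodes (fg : FlowGraph Addr K) : Set Addr := {a | fg.cell a ≠ none}

/-- The right-hand side of the flow equation: the flow of a node is its total inflow together with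
what it receives along the edges from nodes of the graph (sums of flow values are unions). -/
def flowStep (fg : FlowGraph Addr K) : (Addr → Set (EKey K)) →o (Addr → Set (EKey K)) where
  toFun f x := {k | x ∈ fg.nodes ∧
    ((∃ y, y ∉ fg.nodes ∧ k ∈ fg.inflow y x) ∨
      (∃ y c, fg.cell y = some c ∧ k ∈ c.edge x (f y)))}
  monotone' := by
    rintro f g hfg x k ⟨hx, h⟩
    refine ⟨hx, h.imp id ?_⟩
    rintro ⟨y, c, hc, hn, hk⟩
    exact ⟨y, c, hc, hn, hk.imp id fun h => ⟨h.1, hfg y h.2.1, h.2.2⟩⟩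

/-- The flow: the least solution of the flow equation (`∅` at addresses that are not nodes). -/
def flow (fg : FlowGraph Addr K) : Addr → Set (EKey K) := OrderHom.lfp fg.flowStep

/-- The outflow from the node `x` to the address `y`. -/
def out (fg : FlowGraph Addr K) (x y : Addr) : Set (EKey K) :=
  {k | ∃ c, fg.cell x = some c ∧ k ∈ c.edge y (fg.flow x)}

/-- The union of two flow graphs: the inflow that one component receives from the other
is dropped. -/
def join (f₁ f₂ : FlowGraph Addr K) : FlowGraph Addr K where
  cell a := (f₁.cell a).or (f₂.cell a)
  inflow y x := {k | y ∉ f₁.nodes ∪ f₂.nodes ∧ (k ∈ f₁.inflow y x ∨ k ∈ f₂.inflow y x)}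
  finite_nodes := by
    refine (f₁.finite_nodes.union f₂.finite_nodes).subset ?_
    intro a ha
    by_contra h
    simp only [Set.mem_union, Set.mem_ofPred_eq, not_or, not_not] at h
    simp [h.1, h.2] at ha
  inflow_dom := by
    intro y x h
    ext k
    simp only [Set.mem_ofPred_eq, Set.mem_empty_iff_false, iff_false]
    rintro ⟨hy, hk⟩
    simp only [nodes, Set.mem_union, Set.mem_ofPred_eq, not_or, not_not] at hy
    rcases h with h | h
    · simp [hy.1, hy.2] at h
    · rw [Option.or_eq_none_iff] at h
      rw [f₁.inflow_dom y x (Or.inr h.1), f₂.inflow_dom y x (Or.inr h.2)] at hk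
      simp at hk

/-- Definedness of the composition of flow graphs: the nodes are disjoint, the outflow of either
one matches the inflow that the other one expects, and the union has the flow of the components. -/
def Compat (f₁ f₂ : FlowGraph Addr K) : Prop :=
  Disjoint f₁.nodes f₂.nodes ∧
  (∀ x ∈ f₁.nodes, ∀ y ∈ f₂.nodes, f₁.out x y = f₂.inflow x y ∧ f₂.out y x = f₁.inflow y x) ∧
  (∀ x ∈ f₁.nodes, f₁.flow x = (f₁.join f₂).flow x) ∧
  (∀ x ∈ f₂.nodes, f₂.flow x = (f₁.join f₂).flow x)

end FlowGraph

end FlowGraphs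

section States

variable {Addr K GVar LVar : Type*} [LinearOrder K]

/-- A global or a local state: a flow graph and a valuation of the program variables `Var`. -/
structure Part (Addr K Var : Type*) where
  fg : FlowGraph Addr K
  stack : Var → Val Addr K

/-- Composition of global (of local) states: flow graphs are composed, stacks are never split.
`Part.IsComp p₁ p₂ p` says that `p₁` and `p₂` are composable with result `p`. -/
def Part.IsComp {Var : Type*} (p₁ p₂ p : Part Addr K Var) : Prop :=
  p₁.fg.Compat p₂.fg ∧ p.fg = p₁.fg.join p₂.fg ∧ p₁.stack = p₂.stack ∧ p.stack = p₁.stack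

/-- A global and a local state are well-split if their flow graphs can be composed and the global
state does not point into the local heap. -/
def WellSplit (g : Part Addr K GVar) (l : Part Addr K LVar) : Prop :=
  g.fg.Compat l.fg ∧
  (∀ px a, g.stack px = Val.addr a → a ∉ l.fg.nodes) ∧
  (∀ a c, g.fg.cell a = some c → c.next ∉ l.fg.nodes)

/-- States: well-split pairs of a global state `g` and a local state `l`. -/
structure State (Addr K GVar LVar : Type*) [LinearOrder K] where
  g : Part Addr K GVar
  l : Part Addr K LVar
  wellSplit : WellSplit g l

/-- Composition of states is component-wise, and defined only if the result is a state again.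
`IsComp s₁ s₂ s` says that `s₁` and `s₂` are composable with result `s`. -/
def IsComp (s₁ s₂ s : State Addr K GVar LVar) : Prop :=
  s₁.g.IsComp s₂.g s.g ∧ s₁.l.IsComp s₂.l s.l

/-- The units of the separation algebra: both heaps are empty, the stacks are arbitrary. -/
def emp : Set (State Addr K GVar LVar) := {s | s.g.fg.nodes = ∅ ∧ s.l.fg.nodes = ∅}

/-- Separating conjunction of predicates. -/
def sep (p q : Set (State Addr K GVar LVar)) : Set (State Addr K GVar LVar) :=
  {s | ∃ s₁ ∈ p, ∃ s₂ ∈ q, IsComp s₁ s₂ s}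

infixr:65 " ∗ " => sep

/-- Iterated separating conjunction over a finite set of addresses. -/
inductive BigSep (p : Addr → Set (State Addr K GVar LVar)) :
    Finset Addr → State Addr K GVar LVar → Prop where
  | empty (s : State Addr K GVar LVar) (hs : s ∈ emp) : BigSep p ∅ s
  | cons (x : Addr) (N : Finset Addr) (hx : x ∉ N) (s₁ s₂ s : State Addr K GVar LVar)
      (h₁ : s₁ ∈ p x) (h₂ : BigSep p N s₂) (hs : IsComp s₁ s₂ s) : BigSep p (N.cons x hx) s

/-- A formula without resources, which may mention global program variables. -/
def pureP (φ : (GVar → Val Addr K) → Prop) : Set (State Addr K GVar LVar) :=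
  {s | s ∈ emp ∧ φ s.g.stack}

/-- The boxed assertion: the assertion `A` holds of the global state, the local heap is empty. -/
def box (A : Part Addr K GVar → Prop) : Set (State Addr K GVar LVar) :=
  {s | s.l.fg.nodes = ∅ ∧ A s.g}

end States

section Invariant

variable {Addr K GVar LVar : Type*} [LinearOrder K]

/-- A valuation of the logical variables `mark_x, next_x, key_x, flow_x, in_x`, for all `x`;
`inflow x y` is the value of `in_x(y, x)`. -/
structure LogVal (Addr K : Type*) where
  mark : Addr → Bool
  next : Addr → Addr
  key : Addr → EKey K
  flow : Addr → Set (EKey K)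
  inflow : Addr → Addr → Set (EKey K)

namespace LogVal

variable (lv : LogVal Addr K) (head : GVar) (ι : GVar → Val Addr K)

/-- The contents of a node. -/
def nodeContents (x : Addr) : Set (EKey K) := if lv.mark x then ∅ else {lv.key x}

/-- The contents of a set of nodes. -/
def contents (N : Finset Addr) : Set (EKey K) := ⋃ x ∈ N, lv.nodeContents x

open Classical in
/-- The inset of a node: all keys for the head node, the flow for every other node. -/
noncomputable def inset (x : Addr) : Set (EKey K) :=
  if ι head = Val.addr x then Set.univ else lv.flow x

/-- Unmarked nodes have a non-empty inset. -/
def phi1 (x : Addr) : Prop := lv.mark x = false → (lv.inset head ι x).Nonempty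

/-- A non-empty inset contains `[key, ∞)`. -/
def phi2 (x : Addr) : Prop :=
  (lv.inset head ι x).Nonempty → Set.Ico (lv.key x) ⊤ ⊆ lv.inset head ι x

/-- The node and its successor belong to the structure; nodes with key `∞` are unmarked. -/
def phi3 (x : Addr) (N : Finset Addr) : Prop :=
  (x ∈ N ∧ lv.next x ∈ N) ∧ (lv.key x = ⊤ → lv.mark x = false)

/-- At most one inflow is non-empty. -/
def phi4 (x : Addr) : Prop :=
  ∀ y z, (lv.inflow x y).Nonempty ∧ (lv.inflow x z).Nonempty → y = z

/-- The resources of a node: the global heap is a flow graph with the single node `x`, whose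
fields, flow and inflow are the values of the logical variables. -/
def node (x : Addr) : Set (State Addr K GVar LVar) :=
  box fun g => g.fg.nodes = {x} ∧
    g.fg.cell x = some ⟨lv.mark x, lv.next x, lv.key x⟩ ∧
    g.fg.flow x = lv.flow x ∧ ∀ y, g.fg.inflow y x = lv.inflow x y

/-- The head node belongs to the structure, has key `-∞`, and is unmarked. -/
def HD (N : Finset Addr) : Set (State Addr K GVar LVar) :=
  pureP fun ι => ∃ h ∈ N, ι head = Val.addr h ∧ lv.key h = ⊥ ∧ lv.mark h = false

/-- The Harris set invariant `Inv(C, N', N)`, for a given valuation of the logical variables. -/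
def inv (C : Set (EKey K)) (N' N : Finset Addr) : Set (State Addr K GVar LVar) :=
  pureP (fun _ => C = lv.contents N') ∗ lv.HD head N ∗
    {s | BigSep (fun x =>
      lv.node x ∗ pureP (fun ι => lv.phi1 head ι x) ∗ pureP (fun ι => lv.phi2 head ι x) ∗
        pureP (fun _ => lv.phi3 x N) ∗ pureP (fun _ => lv.phi4 x)) N' s}

end LogVal

/-- The Harris set invariant `Inv(C, N', N)` with its logical variables existentially closed. -/
def closedInv (head : GVar) (C : Set (EKey K)) (N' N : Finset Addr) :
    Set (State Addr K GVar LVar) :=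
  {s | ∃ lv : LogVal Addr K, s ∈ lv.inv head C N' N}

/-- The contents, in the global heap of the state `s`, of a set of nodes. -/
def State.contents (s : State Addr K GVar LVar) (N : Finset Addr) : Set (EKey K) :=
  {k | ∃ x ∈ N, ∃ c, s.g.fg.cell x = some c ∧ c.mark = false ∧ c.key = k}

/-- `t` is a complete Harris set structure with the set of nodes `N`: it satisfies the invariant
for the whole set `N`, it receives no flow from outside of `N`, and no node except the head node
has the key `-∞`. -/
def IsStructure (head : GVar) (N : Finset Addr) (t : State Addr K GVar LVar) : Prop :=
  (∃ C, t ∈ closedInv head C N N) ∧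
  (∀ y x, t.g.fg.inflow y x = ∅) ∧
  (∀ x c, t.g.fg.cell x = some c → c.key = ⊥ → t.g.stack head = Val.addr x)

/-- The equivalence that defines decomposability, for the invariant `I`, the disjoint sets of nodes
`N₁` and `N₂`, the set of nodes `N`, and at the state `s`. -/
def DecomposesAt
    (I : Set (EKey K) → Finset Addr → Finset Addr → Set (State Addr K GVar LVar))
    (N₁ N₂ : Finset Addr) (hN : Disjoint N₁ N₂) (N : Finset Addr)
    (s : State Addr K GVar LVar) : Prop :=
  ∀ C, s ∈ I C (N₁.disjUnion N₂ hN) N ↔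
    ∃ C₁ C₂, (C = C₁ ∪ C₂ ∧ Disjoint C₁ C₂) ∧ s ∈ I C₁ N₁ N ∗ I C₂ N₂ N

end Invariant

end HarrisSet

open HarrisSet

/-! A splitting of a flow graph `f` is nothing but a partition of its nodes. The component on `S`
has to be `f.restrict S`, where the outflow of the removed nodes has become inflow, and conversely
restrictions to complementary sets always compose to `f`, with unchanged flow (`flow_restrict`,
`compat_join_iff`). For assertions with empty local heap, separating conjunction therefore only
chooses a partition of the global nodes (`mem_sep_iff`). Since each conjunct for a node owns exactly
that node, the iterated conjunction leaves no choice at all: it says that every one-node restriction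
of the state satisfies its conjunct (`bigSep_iff`). The invariant thus becomes a pointwise condition
together with duplicable pure facts (`mem_inv`), and such a condition splits and recombines along
`N₁` and `N₂`. Under existential closure, the two valuations are glued along `N₁`.

The contents of the parts can be read off the state, so disjoint contents give the disjoint union.
In a complete structure they are disjoint because distinct unmarked nodes have distinct keys
(`IsStructure.key_injective`): every node with nonempty inset is reached from the head along `next`
with strictly increasing keys, and since `next` is a function, any two such nodes lie on one chain.
-/

namespace HarrisSet

/-! ### Flow graphs: the flow equation and induction for the least solution -/

namespace FlowGraph

variable {Addr K : Type*}

theorem mem_nodes {f : FlowGraph Addr K} {a : Addr} : a ∈ f.nodes ↔ f.cell a ≠ none := Iff.rfl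

theorem mem_nodes_of_cell {f : FlowGraph Addr K} {a : Addr} {c : Cell Addr K}
    (h : f.cell a = some c) : a ∈ f.nodes := by
  simp [mem_nodes, h]

theorem not_mem_inflow_of_mem {f : FlowGraph Addr K} {x y : Addr} {k : EKey K} (hy : y ∈ f.nodes) :
    k ∉ f.inflow y x := by
  rw [f.inflow_dom y x (Or.inl hy)]; simp

theorem mem_nodes_of_mem_inflow {f : FlowGraph Addr K} {x y : Addr} {k : EKey K}
    (h : k ∈ f.inflow y x) : x ∈ f.nodes := by
  by_contra hx
  rw [f.inflow_dom y x (Or.inr (not_not.1 hx))] at h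
  exact h

theorem eq_of_nodes_eq_empty {f g : FlowGraph Addr K} (hf : f.nodes = ∅) (hg : g.nodes = ∅) :
    f = g := by
  have hc : ∀ {f : FlowGraph Addr K}, f.nodes = ∅ → ∀ a, f.cell a = none := fun {f} hf a =>
    not_not.1 fun h => (hf ▸ (show a ∈ f.nodes from h) : a ∈ (∅ : Set Addr))
  ext1
  · funext a
    rw [hc hf, hc hg]
  · funext y x
    rw [f.inflow_dom y x (Or.inr (hc hf x)), g.inflow_dom y x (Or.inr (hc hg x))]

theorem nodes_join (f g : FlowGraph Addr K) : (f.join g).nodes = f.nodes ∪ g.nodes := by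
  ext a
  simp only [mem_nodes, join, Set.mem_union, ne_eq, Option.or_eq_none_iff]
  tauto

variable [LinearOrder K]

theorem mem_flow {f : FlowGraph Addr K} {x : Addr} {k : EKey K} :
    k ∈ f.flow x ↔ x ∈ f.nodes ∧ ((∃ y, y ∉ f.nodes ∧ k ∈ f.inflow y x) ∨
      (∃ y, k ∈ f.out y x)) := by
  have h : f.flowStep f.flow = f.flow := OrderHom.map_lfp f.flowStep
  rw [← congrFun h x]
  rfl

theorem flow_le {f : FlowGraph Addr K} {F : Addr → Set (EKey K)}
    (hF : ∀ x ∈ f.nodes, ∀ k, ((∃ y, y ∉ f.nodes ∧ k ∈ f.inflow y x) ∨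
      (∃ y c, f.cell y = some c ∧ k ∈ c.edge x (F y))) → k ∈ F x) (x : Addr) :
    f.flow x ⊆ F x := by
  have h : f.flow ≤ F := OrderHom.lfp_le f.flowStep fun x k hk => hF x hk.1 k hk.2
  exact h x

theorem out_eq_empty {f : FlowGraph Addr K} {x : Addr} (hx : x ∉ f.nodes) (y : Addr) :
    f.out x y = ∅ := by
  ext k
  simp only [Set.mem_empty_iff_false, iff_false]
  rintro ⟨c, hc, -⟩
  exact hx (mem_nodes_of_cell hc)

theorem edge_mono {c : Cell Addr K} {y : Addr} {m m' : Set (EKey K)} (h : m ⊆ m') :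
    c.edge y m ⊆ c.edge y m' :=
  fun _ hk => ⟨hk.1, hk.2.imp id fun hk => ⟨hk.1, h hk.2.1, hk.2.2⟩⟩

/-! ### Restriction of flow graphs, and splittings as partitions of the nodes -/

open Classical in
/-- The part of a flow graph on the addresses in `S`: the outflow of the removed nodes becomes
inflow. -/
noncomputable def restrict (f : FlowGraph Addr K) (S : Set Addr) : FlowGraph Addr K where
  cell a := if a ∈ S then f.cell a else none
  inflow y x := {k | x ∈ S ∧ x ∈ f.nodes ∧ ¬ (y ∈ S ∧ y ∈ f.nodes) ∧
    (k ∈ f.inflow y x ∨ k ∈ f.out y x)}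
  finite_nodes := f.finite_nodes.subset fun a ha => by
    by_cases h : a ∈ S <;> simp_all
  inflow_dom y x h := by
    ext k
    simp only [Set.mem_ofPred_eq, Set.mem_empty_iff_false, iff_false]
    rintro ⟨hx, hxn, hy, -⟩
    rw [if_pos hx] at h
    refine h.elim (fun h => hy ?_) hxn
    by_cases hyS : y ∈ S
    · exact ⟨hyS, by simpa [mem_nodes, hyS] using h⟩
    · simp [hyS] at h

variable (f : FlowGraph Addr K) {S T : Set Addr}

theorem restrict_cell {x : Addr} (hx : x ∈ S) : (f.restrict S).cell x = f.cell x := if_pos hx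

theorem restrict_cell_of_notMem {x : Addr} (hx : x ∉ S) : (f.restrict S).cell x = none :=
  if_neg hx

theorem mem_restrict_inflow {x y : Addr} {k : EKey K} :
    k ∈ (f.restrict S).inflow y x ↔ x ∈ S ∧ x ∈ f.nodes ∧ ¬ (y ∈ S ∧ y ∈ f.nodes) ∧
      (k ∈ f.inflow y x ∨ k ∈ f.out y x) := Iff.rfl

theorem mem_nodes_restrict {x : Addr} : x ∈ (f.restrict S).nodes ↔ x ∈ S ∧ x ∈ f.nodes := by
  by_cases h : x ∈ S
  · simp [mem_nodes, restrict_cell f h, h]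
  · simp [mem_nodes, restrict_cell_of_notMem f h, h]

theorem nodes_restrict : (f.restrict S).nodes = S ∩ f.nodes :=
  Set.ext fun _ => mem_nodes_restrict f

/-- Both inclusions are fixed-point inductions: each flow, suitably cut down, is a pre-solution of
the other flow equation. -/
theorem flow_restrict {x : Addr} (hx : x ∈ S) : (f.restrict S).flow x = f.flow x := by
  have hle : ∀ z, (f.restrict S).flow z ⊆ {k | z ∈ S ∧ k ∈ f.flow z} := by
    refine flow_le fun z hz k hk => ?_
    rw [mem_nodes_restrict] at hz
    refine ⟨hz.1, ?_⟩
    rcases hk with ⟨y, hy, hk⟩ | ⟨y, c, hc, hk⟩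
    · obtain ⟨-, -, -, hk | hk⟩ := (mem_restrict_inflow f).1 hk
      · exact mem_flow.2 ⟨hz.2, Or.inl ⟨y, fun h => not_mem_inflow_of_mem h hk, hk⟩⟩
      · exact mem_flow.2 ⟨hz.2, Or.inr ⟨y, hk⟩⟩
    · have hy : y ∈ S := by
        by_contra hy
        simp [restrict_cell_of_notMem f hy] at hc
      rw [restrict_cell f hy] at hc
      exact mem_flow.2 ⟨hz.2, Or.inr ⟨y, c, hc, edge_mono (fun _ h => h.2) hk⟩⟩
  refine Set.Subset.antisymm (fun k hk => (hle x hk).2) ?_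
  -- The first conjunct keeps track of the flow outside of `S`, whose outflow is counted as inflow
  -- of the restriction.
  have hge : ∀ z, f.flow z ⊆ {k | k ∈ f.flow z ∧ (z ∈ S → k ∈ (f.restrict S).flow z)} := by
    refine flow_le fun z hz k hk => ⟨?_, fun hzS => ?_⟩
    · refine mem_flow.2 ⟨hz, hk.imp id ?_⟩
      rintro ⟨y, c, hc, hk⟩
      exact ⟨y, c, hc, edge_mono (fun _ h => h.1) hk⟩
    · refine mem_flow.2 ⟨(mem_nodes_restrict f).2 ⟨hzS, hz⟩, ?_⟩
      rcases hk with ⟨y, hy, hk⟩ | ⟨y, c, hc, hk⟩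
      · exact Or.inl ⟨y, fun h => hy ((mem_nodes_restrict f).1 h).2, hzS, hz, fun h => hy h.2,
          Or.inl hk⟩
      · by_cases hyS : y ∈ S
        · exact Or.inr ⟨y, c, (restrict_cell f hyS).trans hc, edge_mono (fun _ h => h.2 hyS) hk⟩
        · exact Or.inl ⟨y, fun h => hyS ((mem_nodes_restrict f).1 h).1, hzS, hz, fun h => hyS h.1,
            Or.inr ⟨c, hc, edge_mono (fun _ h => h.1) hk⟩⟩
  exact fun k hk => (hge x hk).2 hx

theorem out_restrict {x : Addr} (hx : x ∈ S) (y : Addr) : (f.restrict S).out x y = f.out x y := by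
  simp only [out, restrict_cell f hx, flow_restrict f hx]

theorem restrict_restrict (h : T ⊆ S) : (f.restrict S).restrict T = f.restrict T := by
  ext1
  · funext a
    by_cases ha : a ∈ T
    · rw [restrict_cell _ ha, restrict_cell _ ha, restrict_cell _ (h ha)]
    · rw [restrict_cell_of_notMem _ ha, restrict_cell_of_notMem _ ha]
  · funext y x
    ext k
    simp only [mem_restrict_inflow, mem_nodes_restrict]
    -- What `y` sends to `x` is still outflow in `f.restrict S` if `y ∈ S`; otherwise it has already
    -- become inflow there.
    by_cases hy : y ∈ S
    · rw [out_restrict f hy]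
      have hi : y ∈ f.nodes → k ∉ f.inflow y x := fun h => not_mem_inflow_of_mem h
      have := @h x
      tauto
    · rw [out_eq_empty (f := f.restrict S) (fun h => hy ((mem_nodes_restrict f).1 h).1)]
      have := @h x
      simp only [Set.mem_empty_iff_false]
      tauto

theorem restrict_eq_self (h : f.nodes ⊆ S) : f.restrict S = f := by
  ext1
  · funext a
    by_cases ha : a ∈ S
    · exact restrict_cell f ha
    · rw [restrict_cell_of_notMem f ha]
      exact (not_not.1 fun h' => ha (h h')).symm
  · funext y x
    ext k
    rw [mem_restrict_inflow]
    constructor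
    · rintro ⟨-, -, hy, hk | hk⟩
      · exact hk
      · rw [out_eq_empty fun h' => hy ⟨h h', h'⟩] at hk
        exact hk.elim
    · intro hk
      have hx := mem_nodes_of_mem_inflow hk
      exact ⟨h hx, hx, fun hy => not_mem_inflow_of_mem hy.2 hk, Or.inl hk⟩

variable {f}

theorem join_restrict (hST : Disjoint S T) (h : f.nodes ⊆ S ∪ T) :
    (f.restrict S).join (f.restrict T) = f := by
  ext1
  · funext a
    show ((f.restrict S).cell a).or ((f.restrict T).cell a) = f.cell a
    by_cases hS : a ∈ S
    · rw [restrict_cell _ hS, restrict_cell_of_notMem _ (Set.disjoint_left.1 hST hS)]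
      simp
    · rw [restrict_cell_of_notMem _ hS]
      by_cases hT : a ∈ T
      · rw [restrict_cell _ hT]; simp
      · rw [restrict_cell_of_notMem _ hT]
        exact (not_not.1 fun h' => (h h').elim hS hT).symm
  · funext y x
    ext k
    show (y ∉ _ ∧ _) ↔ _
    simp only [mem_restrict_inflow, Set.mem_union, mem_nodes_restrict]
    constructor
    · rintro ⟨hy, hk⟩
      have : y ∉ f.nodes := fun h' => by
        have := h h'
        simp only [Set.mem_union] at this
        tauto
      rw [out_eq_empty this] at hk
      simp only [Set.mem_empty_iff_false] at hk
      tauto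
    · intro hk
      have hx := mem_nodes_of_mem_inflow hk
      have hy : y ∉ f.nodes := fun h => not_mem_inflow_of_mem h hk
      have := h hx
      simp only [Set.mem_union] at this
      tauto

theorem compat_restrict (hST : Disjoint S T) (h : f.nodes ⊆ S ∪ T) :
    (f.restrict S).Compat (f.restrict T) := by
  refine ⟨?_, ?_, ?_, ?_⟩
  · rw [nodes_restrict, nodes_restrict]
    exact hST.mono Set.inter_subset_left Set.inter_subset_left
  · have key : ∀ {S T : Set Addr}, Disjoint S T → ∀ x ∈ (f.restrict S).nodes,
        ∀ y ∈ (f.restrict T).nodes, (f.restrict S).out x y = (f.restrict T).inflow x y := by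
      intro S T hST x hx y hy
      rw [mem_nodes_restrict] at hx hy
      rw [out_restrict f hx.1]
      ext k
      rw [mem_restrict_inflow]
      exact ⟨fun hk => ⟨hy.1, hy.2, fun h => Set.disjoint_left.1 hST hx.1 h.1, Or.inr hk⟩,
        fun hk => hk.2.2.2.resolve_left (not_mem_inflow_of_mem hx.2)⟩
    exact fun x hx y hy => ⟨key hST x hx y hy, key hST.symm y hy x hx⟩
  · intro x hx
    rw [join_restrict hST h]
    exact flow_restrict f ((mem_nodes_restrict f).1 hx).1
  · intro x hx
    rw [join_restrict hST h]
    exact flow_restrict f ((mem_nodes_restrict f).1 hx).1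

theorem Compat.symm {f₁ f₂ : FlowGraph Addr K} (h : f₁.Compat f₂) :
    f₂.Compat f₁ ∧ f₂.join f₁ = f₁.join f₂ := by
  have hj : f₂.join f₁ = f₁.join f₂ := by
    ext1
    · funext a
      show (f₂.cell a).or (f₁.cell a) = (f₁.cell a).or (f₂.cell a)
      by_cases h₁ : a ∈ f₁.nodes
      · rw [not_not.1 (Set.disjoint_left.1 h.1 h₁)]; simp
      · rw [not_not.1 h₁]; simp
    · funext y x
      ext k
      show (y ∉ _ ∧ _) ↔ (y ∉ _ ∧ _)
      rw [Set.union_comm, or_comm]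
  exact ⟨⟨h.1.symm, fun x hx y hy => (h.2.1 y hy x hx).symm, hj ▸ h.2.2.2, hj ▸ h.2.2.1⟩, hj⟩

/-- A component is determined by the composite. The interface condition makes the inflow from `f₂`
equal to the outflow of `f₂`, and agreement of the flows makes the latter equal to the outflow in
the composite. -/
theorem Compat.restrict_left {f₁ f₂ : FlowGraph Addr K} (h : f₁.Compat f₂) :
    (f₁.join f₂).restrict f₁.nodes = f₁ := by
  obtain ⟨hd, ho, hf₁, hf₂⟩ := h
  ext1
  · funext a
    by_cases ha : a ∈ f₁.nodes
    · rw [restrict_cell _ ha]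
      show (f₁.cell a).or (f₂.cell a) = _
      rw [not_not.1 (Set.disjoint_left.1 hd ha)]; simp
    · rw [restrict_cell_of_notMem _ ha, not_not.1 ha]
  · funext y x
    ext k
    rw [mem_restrict_inflow, nodes_join]
    by_cases hx : x ∈ f₁.nodes
    swap
    · exact ⟨fun h => absurd h.1 hx, fun h => absurd (mem_nodes_of_mem_inflow h) hx⟩
    by_cases hy : y ∈ f₁.nodes
    · exact ⟨fun h => absurd ⟨hy, Or.inl hy⟩ h.2.2.1, fun h => absurd h (not_mem_inflow_of_mem hy)⟩
    have hi : k ∉ f₂.inflow y x := fun h =>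
      Set.disjoint_left.1 hd hx (mem_nodes_of_mem_inflow h)
    have hj : k ∈ (f₁.join f₂).inflow y x ↔ y ∉ f₂.nodes ∧ k ∈ f₁.inflow y x := by
      show (y ∉ _ ∧ _) ↔ _
      simp only [Set.mem_union]
      tauto
    rw [hj]
    by_cases hy₂ : y ∈ f₂.nodes
    · have : (f₁.join f₂).out y x = f₂.out y x := by
        have hc : (f₁.join f₂).cell y = f₂.cell y := by
          show (f₁.cell y).or (f₂.cell y) = _
          rw [not_not.1 hy]; simp
        simp only [out, hc, hf₂ y hy₂]
      rw [this, (ho x hx y hy₂).2]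
      simp only [Set.mem_union]
      tauto
    · rw [out_eq_empty (f := f₁.join f₂) (x := y) (by rw [nodes_join]; simp [hy, hy₂])]
      simp only [Set.mem_union, Set.mem_empty_iff_false]
      tauto

/-- Splittings of a flow graph are the partitions of its nodes. -/
theorem compat_join_iff {f₁ f₂ : FlowGraph Addr K} :
    f₁.Compat f₂ ∧ f = f₁.join f₂ ↔ ∃ S T, Disjoint S T ∧ f.nodes = S ∪ T ∧
      f₁ = f.restrict S ∧ f₂ = f.restrict T := by
  constructor
  · rintro ⟨h, rfl⟩
    refine ⟨_, _, h.1, nodes_join _ _, h.restrict_left.symm, ?_⟩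
    rw [← h.symm.2, h.symm.1.restrict_left]
  · rintro ⟨S, T, hd, hn, rfl, rfl⟩
    exact ⟨compat_restrict hd hn.subset, (join_restrict hd hn.subset).symm⟩

theorem compat_of_nodes_eq_empty {g : FlowGraph Addr K} (hg : g.nodes = ∅) : f.Compat g := by
  have h := compat_restrict (f := f) (S := f.nodes) (T := ∅) disjoint_bot_right (by simp)
  rwa [restrict_eq_self f subset_rfl,
    eq_of_nodes_eq_empty (f := f.restrict ∅) (g := g) (by simp [nodes_restrict]) hg] at h

end FlowGraph

/-! ### Splittings of states and separating conjunction -/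

section Splitting

variable {Addr K GVar LVar : Type*} [LinearOrder K]

/-- The global state on the addresses in `S`, with an empty local heap. -/
noncomputable def State.sub (s : State Addr K GVar LVar) (S : Set Addr) :
    State Addr K GVar LVar where
  g := ⟨s.g.fg.restrict S, s.g.stack⟩
  l := ⟨s.l.fg.restrict ∅, s.l.stack⟩
  wellSplit := by
    have h : (s.l.fg.restrict ∅).nodes = ∅ := by simp [FlowGraph.nodes_restrict]
    exact ⟨FlowGraph.compat_of_nodes_eq_empty h, by simp [h], by simp [h]⟩

theorem State.ext_parts {s t : State Addr K GVar LVar} (hg : s.g = t.g) (hl : s.l = t.l) :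
    s = t := by
  cases s; cases t; simp_all

theorem State.nodes_sub (s : State Addr K GVar LVar) (S : Set Addr) :
    (s.sub S).g.fg.nodes = S ∩ s.g.fg.nodes := FlowGraph.nodes_restrict _

theorem State.local_nodes_sub (s : State Addr K GVar LVar) (S : Set Addr) :
    (s.sub S).l.fg.nodes = ∅ := (FlowGraph.nodes_restrict _).trans (Set.empty_inter _)

theorem State.sub_sub (s : State Addr K GVar LVar) {S T : Set Addr} (h : T ⊆ S) :
    (s.sub S).sub T = s.sub T := by
  refine State.ext_parts ?_ ?_
  · simp only [State.sub, FlowGraph.restrict_restrict _ h]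
  · simp only [State.sub, FlowGraph.restrict_restrict _ subset_rfl]

theorem Part.isComp_iff {Var : Type*} {p₁ p₂ p : Part Addr K Var} :
    p₁.IsComp p₂ p ↔ ∃ S T, Disjoint S T ∧ p.fg.nodes = S ∪ T ∧
      p₁ = ⟨p.fg.restrict S, p.stack⟩ ∧ p₂ = ⟨p.fg.restrict T, p.stack⟩ := by
  obtain ⟨f₁, σ₁⟩ := p₁
  obtain ⟨f₂, σ₂⟩ := p₂
  simp only [Part.IsComp, Part.mk.injEq]
  constructor
  · rintro ⟨hc, hj, h, h'⟩
    obtain ⟨S, T, hd, hn, h₁, h₂⟩ := FlowGraph.compat_join_iff.1 ⟨hc, hj⟩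
    exact ⟨S, T, hd, hn, ⟨h₁, h'.symm⟩, h₂, (h'.trans h).symm⟩
  · rintro ⟨S, T, hd, hn, ⟨h₁, e₁⟩, h₂, e₂⟩
    obtain ⟨hc, hj⟩ := FlowGraph.compat_join_iff.2 ⟨S, T, hd, hn, h₁, h₂⟩
    exact ⟨hc, hj, e₁.trans e₂.symm, e₁.symm⟩

theorem Part.IsComp.symm {Var : Type*} {p₁ p₂ p : Part Addr K Var} (h : p₁.IsComp p₂ p) :
    p₂.IsComp p₁ p := by
  obtain ⟨S, T, hd, hn, h₁, h₂⟩ := Part.isComp_iff.1 h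
  exact Part.isComp_iff.2 ⟨T, S, hd.symm, hn.trans (Set.union_comm _ _), h₂, h₁⟩

theorem Part.isComp_of_nodes_eq_empty {Var : Type*} {p₁ p₂ p : Part Addr K Var}
    (h₁ : p₁.fg.nodes = ∅) : p₁.IsComp p₂ p ↔ p₁.stack = p.stack ∧ p₂ = p := by
  rw [Part.isComp_iff]
  constructor
  · rintro ⟨S, T, hd, hn, rfl, rfl⟩
    simp only [FlowGraph.nodes_restrict] at h₁
    have : S = ∅ := by rwa [hn, Set.inter_eq_left.2 Set.subset_union_left] at h₁
    subst this
    refine ⟨rfl, ?_⟩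
    rw [FlowGraph.restrict_eq_self _ (hn.trans (Set.empty_union T)).subset]
  · rintro ⟨h, rfl⟩
    refine ⟨∅, p₂.fg.nodes, disjoint_bot_left, by simp, ?_, ?_⟩
    · obtain ⟨f₁, σ₁⟩ := p₁
      rw [Part.mk.injEq]
      exact ⟨FlowGraph.eq_of_nodes_eq_empty h₁ (by simp [FlowGraph.nodes_restrict]), h⟩
    · rw [FlowGraph.restrict_eq_self _ subset_rfl]

theorem sep_comm (p q : Set (State Addr K GVar LVar)) : p ∗ q = q ∗ p := by
  ext s
  constructor <;>
  · rintro ⟨s₁, h₁, s₂, h₂, hg, hl⟩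
    exact ⟨s₂, h₂, s₁, h₁, hg.symm, hl.symm⟩

/-- Pure formulas only see the stack, which composition never splits, and a state with empty heaps
acts as a unit. -/
theorem mem_pureP_sep {φ : (GVar → Val Addr K) → Prop} {q : Set (State Addr K GVar LVar)}
    {s : State Addr K GVar LVar} : s ∈ pureP φ ∗ q ↔ φ s.g.stack ∧ s ∈ q := by
  constructor
  · rintro ⟨s₁, ⟨⟨hg₁, hl₁⟩, hφ⟩, s₂, h₂, hg, hl⟩
    obtain ⟨hg, hg'⟩ := (Part.isComp_of_nodes_eq_empty hg₁).1 hg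
    obtain ⟨-, hl'⟩ := (Part.isComp_of_nodes_eq_empty hl₁).1 hl
    obtain rfl := State.ext_parts hg' hl'
    exact ⟨hg ▸ hφ, h₂⟩
  · rintro ⟨hφ, hs⟩
    have hn : (s.sub ∅).g.fg.nodes = ∅ := by simp [State.nodes_sub]
    have hl := s.local_nodes_sub ∅
    exact ⟨s.sub ∅, ⟨⟨hn, hl⟩, hφ⟩, s, hs, (Part.isComp_of_nodes_eq_empty hn).2 ⟨rfl, rfl⟩,
      (Part.isComp_of_nodes_eq_empty hl).2 ⟨rfl, rfl⟩⟩

theorem mem_sep_pureP {φ : (GVar → Val Addr K) → Prop} {q : Set (State Addr K GVar LVar)}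
    {s : State Addr K GVar LVar} : s ∈ q ∗ pureP φ ↔ s ∈ q ∧ φ s.g.stack := by
  rw [sep_comm, mem_pureP_sep, and_comm]

theorem pureP_sep_pureP (φ ψ : (GVar → Val Addr K) → Prop) :
    (pureP φ ∗ pureP ψ : Set (State Addr K GVar LVar)) = pureP fun ι => φ ι ∧ ψ ι := by
  ext s
  rw [mem_pureP_sep]
  simp only [pureP, Set.mem_ofPred_eq]
  tauto

/-- Separating conjunction of predicates that force the local heap to be empty. -/
theorem mem_sep_iff {p q : Set (State Addr K GVar LVar)} (hp : ∀ s ∈ p, s.l.fg.nodes = ∅)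
    (hq : ∀ s ∈ q, s.l.fg.nodes = ∅) {s : State Addr K GVar LVar} :
    s ∈ p ∗ q ↔ s.l.fg.nodes = ∅ ∧ ∃ S T, Disjoint S T ∧ s.g.fg.nodes = S ∪ T ∧
      s.sub S ∈ p ∧ s.sub T ∈ q := by
  constructor
  · rintro ⟨s₁, h₁, s₂, h₂, hg, hl⟩
    obtain ⟨e, e'⟩ := (Part.isComp_of_nodes_eq_empty (hp _ h₁)).1 hl
    have hs : s.l.fg.nodes = ∅ := e' ▸ hq _ h₂
    have hl₀ : s.l.fg.restrict ∅ = s.l.fg := FlowGraph.restrict_eq_self _ hs.subset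
    obtain ⟨S, T, hd, hn, g₁, g₂⟩ := Part.isComp_iff.1 hg
    have e₁ : s₁ = s.sub S := by
      refine State.ext_parts g₁ ?_
      show s₁.l = ⟨s.l.fg.restrict ∅, s.l.stack⟩
      rw [← e, hl₀, FlowGraph.eq_of_nodes_eq_empty hs (hp _ h₁)]
    have e₂ : s₂ = s.sub T := by
      refine State.ext_parts g₂ ?_
      show s₂.l = ⟨s.l.fg.restrict ∅, s.l.stack⟩
      rw [e', hl₀]
    exact ⟨hs, S, T, hd, hn, e₁ ▸ h₁, e₂ ▸ h₂⟩
  · rintro ⟨hs, S, T, hd, hn, h₁, h₂⟩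
    refine ⟨_, h₁, _, h₂, Part.isComp_iff.2 ⟨S, T, hd, hn, rfl, rfl⟩, ?_⟩
    refine (Part.isComp_of_nodes_eq_empty (hp _ h₁)).2 ⟨rfl, ?_⟩
    show Part.mk (s.l.fg.restrict ∅) s.l.stack = s.l
    rw [FlowGraph.restrict_eq_self _ hs.subset]

variable {p : Addr → Set (State Addr K GVar LVar)}

/-- The induction step of `bigSep_iff`; the node sets of the two predicates force the partition to
be `{x}` and `N`. -/
theorem mem_sep_forall_iff (hp : ∀ x, ∀ s ∈ p x, s.l.fg.nodes = ∅ ∧ s.g.fg.nodes = {x})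
    {x : Addr} {N : Finset Addr} (hx : x ∉ N) {s : State Addr K GVar LVar} :
    s ∈ p x ∗ {s | s.l.fg.nodes = ∅ ∧ s.g.fg.nodes = N ∧ ∀ x ∈ N, s.sub {x} ∈ p x} ↔
      s.l.fg.nodes = ∅ ∧ s.g.fg.nodes = N.cons x hx ∧ ∀ y ∈ N.cons x hx, s.sub {y} ∈ p y := by
  rw [mem_sep_iff (fun s hs => (hp x s hs).1) (fun s hs => hs.1)]
  refine and_congr_right fun hl => ?_
  rw [Finset.coe_cons, Set.insert_eq]
  constructor
  · rintro ⟨S, T, hd, hn, h₁, -, hT, h₂⟩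
    obtain rfl : S = {x} := by
      have := (hp _ _ h₁).2
      rwa [State.nodes_sub, hn, Set.inter_eq_left.2 Set.subset_union_left] at this
    obtain rfl : T = N := by
      rwa [State.nodes_sub, hn, Set.inter_eq_left.2 Set.subset_union_right] at hT
    refine ⟨hn, fun y hy => ?_⟩
    rcases Finset.mem_cons.1 hy with rfl | hy
    · exact h₁
    · have := h₂ y hy
      rwa [State.sub_sub _ (by simpa using hy)] at this
  · rintro ⟨hn, h⟩
    refine ⟨{x}, N, by simpa using hx, hn, h x (Finset.mem_cons_self x N),
      State.local_nodes_sub _ _, ?_, fun y hy => ?_⟩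
    · rw [State.nodes_sub, hn, Set.inter_eq_left.2 Set.subset_union_right]
    · rw [State.sub_sub _ (by simpa using hy)]
      exact h y (Finset.mem_cons_of_mem hy)

theorem bigSep_iff (hp : ∀ x, ∀ s ∈ p x, s.l.fg.nodes = ∅ ∧ s.g.fg.nodes = {x})
    {N : Finset Addr} {s : State Addr K GVar LVar} :
    BigSep p N s ↔ s.l.fg.nodes = ∅ ∧ s.g.fg.nodes = N ∧ ∀ x ∈ N, s.sub {x} ∈ p x := by
  constructor
  · intro h
    induction h with
    | empty s hs => exact ⟨hs.2, by simpa using hs.1, by simp⟩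
    | cons x N hx s₁ s₂ s h₁ _ hs ih => exact (mem_sep_forall_iff hp hx).1 ⟨s₁, h₁, s₂, ih, hs⟩
  · induction N using Finset.cons_induction generalizing s with
    | empty => exact fun h => .empty s ⟨by simpa using h.2.1, h.1⟩
    | cons x N hx ih =>
      intro h
      obtain ⟨s₁, h₁, s₂, h₂, hs⟩ := (mem_sep_forall_iff hp hx).2 h
      exact .cons x N hx s₁ s₂ s h₁ (ih h₂) hs

end Splitting

/-! ### The invariant as a pointwise condition, and its decomposition -/

section Decomposition

variable {Addr K GVar LVar : Type*}

namespace LogVal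

variable {lv lv' : LogVal Addr K}

theorem contents_disjUnion {N₁ N₂ : Finset Addr} (hN : Disjoint N₁ N₂) :
    lv.contents (N₁.disjUnion N₂ hN) = lv.contents N₁ ∪ lv.contents N₂ := by
  ext k
  simp only [contents, Set.mem_iUnion, Finset.mem_disjUnion, Set.mem_union, exists_prop]
  constructor
  · rintro ⟨x, hx | hx, hk⟩
    exacts [Or.inl ⟨x, hx, hk⟩, Or.inr ⟨x, hx, hk⟩]
  · rintro (⟨x, hx, hk⟩ | ⟨x, hx, hk⟩)
    exacts [⟨x, Or.inl hx, hk⟩, ⟨x, Or.inr hx, hk⟩]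

/-- Two valuations agree on the variables of the node `x`. -/
def AgreeAt (lv lv' : LogVal Addr K) (x : Addr) : Prop :=
  lv.mark x = lv'.mark x ∧ lv.next x = lv'.next x ∧ lv.key x = lv'.key x ∧
    lv.flow x = lv'.flow x ∧ lv.inflow x = lv'.inflow x

theorem contents_congr {N' : Finset Addr} (h : ∀ x ∈ N', AgreeAt lv lv' x) :
    lv.contents N' = lv'.contents N' := by
  refine Set.iUnion₂_congr fun x hx => ?_
  rw [nodeContents, nodeContents, (h x hx).1, (h x hx).2.2.1]

open Classical in
/-- The valuation that is `lv` on `S` and `lv'` elsewhere. -/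
noncomputable def merge (S : Finset Addr) (lv lv' : LogVal Addr K) : LogVal Addr K where
  mark x := if x ∈ S then lv.mark x else lv'.mark x
  next x := if x ∈ S then lv.next x else lv'.next x
  key x := if x ∈ S then lv.key x else lv'.key x
  flow x := if x ∈ S then lv.flow x else lv'.flow x
  inflow x := if x ∈ S then lv.inflow x else lv'.inflow x

theorem agreeAt_merge_left {S : Finset Addr} {x : Addr} (hx : x ∈ S) :
    AgreeAt lv (merge S lv lv') x := by
  simp [AgreeAt, merge, hx]

theorem agreeAt_merge_right {S : Finset Addr} {x : Addr} (hx : x ∉ S) :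
    AgreeAt lv' (merge S lv lv') x := by
  simp [AgreeAt, merge, hx]

end LogVal

variable [LinearOrder K]

namespace LogVal

variable (lv : LogVal Addr K) (head : GVar) (N : Finset Addr)

/-- The conjunct of the invariant for the node `x`. -/
def nodeInv (x : Addr) : Set (State Addr K GVar LVar) :=
  lv.node x ∗ pureP (fun ι => lv.phi1 head ι x) ∗ pureP (fun ι => lv.phi2 head ι x) ∗
    pureP (fun _ => lv.phi3 x N) ∗ pureP (fun _ => lv.phi4 x)

variable {lv head N}

theorem mem_nodeInv {x : Addr} {s : State Addr K GVar LVar} :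
    s ∈ lv.nodeInv head N x ↔ s ∈ lv.node x ∧ lv.phi1 head s.g.stack x ∧
      lv.phi2 head s.g.stack x ∧ lv.phi3 x N ∧ lv.phi4 x := by
  simp only [nodeInv, pureP_sep_pureP, mem_sep_pureP]

/-- This form mentions no splitting other than into single nodes, so that decomposing the invariant
reduces to splitting a universal quantifier. -/
theorem mem_inv {C : Set (EKey K)} {N' : Finset Addr} {s : State Addr K GVar LVar} :
    s ∈ lv.inv head C N' N ↔ C = lv.contents N' ∧
      (∃ h ∈ N, s.g.stack head = Val.addr h ∧ lv.key h = ⊥ ∧ lv.mark h = false) ∧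
      s.l.fg.nodes = ∅ ∧ s.g.fg.nodes = N' ∧ ∀ x ∈ N', s.sub {x} ∈ lv.nodeInv head N x := by
  rw [inv, mem_pureP_sep, HD, mem_pureP_sep]
  refine and_congr_right fun _ => and_congr_right fun _ => bigSep_iff fun x s hs => ?_
  obtain ⟨hl, hn, -⟩ := (mem_nodeInv.1 hs).1
  exact ⟨hl, hn⟩

theorem local_nodes_of_mem_inv {C : Set (EKey K)} {N' : Finset Addr}
    {s : State Addr K GVar LVar} (h : s ∈ lv.inv head C N' N) : s.l.fg.nodes = ∅ :=
  (mem_inv.1 h).2.2.1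

/-- The conjunct for `x` mentions only the logical variables of `x`, which is what allows valuations
to be glued. -/
theorem AgreeAt.mem_nodeInv {lv' : LogVal Addr K} {x : Addr} (h : AgreeAt lv lv' x) {s : State Addr K GVar LVar}
    (hs : s ∈ lv.nodeInv head N x) : s ∈ lv'.nodeInv head N x := by
  obtain ⟨h₁, h₂, h₃, h₄, h₅⟩ := h
  rw [LogVal.mem_nodeInv] at hs ⊢
  simpa only [node, phi1, phi2, phi3, phi4, inset, h₁, h₂, h₃, h₄, h₅] using hs

variable {N₁ N₂ : Finset Addr} {C C₁ C₂ : Set (EKey K)} {s : State Addr K GVar LVar}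

theorem mem_inv_disjUnion (hN : Disjoint N₁ N₂) (h : s ∈ lv.inv head C (N₁.disjUnion N₂ hN) N) :
    C = lv.contents N₁ ∪ lv.contents N₂ ∧
      s ∈ lv.inv head (lv.contents N₁) N₁ N ∗ lv.inv head (lv.contents N₂) N₂ N := by
  obtain ⟨hC, hh, hl, hn, hx⟩ := mem_inv.1 h
  refine ⟨hC.trans (contents_disjUnion hN), ?_⟩
  rw [Finset.coe_disjUnion] at hn
  rw [mem_sep_iff (fun _ => local_nodes_of_mem_inv) (fun _ => local_nodes_of_mem_inv)]
  have key : ∀ M : Finset Addr, M ⊆ N₁.disjUnion N₂ hN →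
      s.sub M ∈ lv.inv head (lv.contents M) M N := by
    intro M hM
    refine mem_inv.2 ⟨rfl, hh, State.local_nodes_sub _ _, ?_, fun x hxM => ?_⟩
    · rw [State.nodes_sub, hn, ← Finset.coe_disjUnion hN]
      exact Set.inter_eq_left.2 (Finset.coe_subset.2 hM)
    · rw [State.sub_sub _ (by simpa using hxM)]
      exact hx x (hM hxM)
  exact ⟨hl, N₁, N₂, Finset.disjoint_coe.2 hN, hn, key N₁ fun x hx => by simp [hx],
    key N₂ fun x hx => by simp [hx]⟩

/-- Serves both readings of the invariant: a fixed valuation is the case of three equal ones.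
Agreement with `lv₂` is required everywhere off `N₁`, and not just on `N₂`, because the head may lie
in neither set. -/
theorem mem_inv_merge {lv₁ lv₂ : LogVal Addr K} (hN : Disjoint N₁ N₂)
    (h : s ∈ lv₁.inv head C₁ N₁ N ∗ lv₂.inv head C₂ N₂ N)
    (hlv₁ : ∀ x ∈ N₁, AgreeAt lv₁ lv x) (hlv₂ : ∀ x, x ∉ N₁ → AgreeAt lv₂ lv x) :
    s ∈ lv.inv head (C₁ ∪ C₂) (N₁.disjUnion N₂ hN) N := by
  rw [mem_sep_iff (fun _ => local_nodes_of_mem_inv) (fun _ => local_nodes_of_mem_inv)] at h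
  obtain ⟨hl, S, T, hd, hn, h₁, h₂⟩ := h
  obtain ⟨hC₁, ⟨a, haN, ha, ha₁⟩, -, hn₁, hx₁⟩ := mem_inv.1 h₁
  obtain ⟨hC₂, ⟨b, -, hb, hb₂⟩, -, hn₂, hx₂⟩ := mem_inv.1 h₂
  rw [State.nodes_sub, hn, Set.inter_eq_left.2 Set.subset_union_left] at hn₁
  rw [State.nodes_sub, hn, Set.inter_eq_left.2 Set.subset_union_right] at hn₂
  subst hn₁ hn₂
  obtain rfl : a = b := Val.addr.inj (ha.symm.trans hb)
  have hlv₂' : ∀ x ∈ N₂, AgreeAt lv₂ lv x := fun x hx =>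
    hlv₂ x fun hx' => Finset.disjoint_left.1 hN hx' hx
  refine mem_inv.2 ⟨?_, ⟨a, haN, ha, ?_⟩, hl, hn.trans (Finset.coe_disjUnion hN).symm, ?_⟩
  · rw [contents_disjUnion, hC₁, hC₂, contents_congr hlv₁, contents_congr hlv₂']
  -- Both parts assert the facts on the head; the one used is that of the valuation which `lv`
  -- follows at the head.
  · by_cases haN₁ : a ∈ N₁
    · obtain ⟨e₁, -, e₂, -⟩ := hlv₁ a haN₁
      rwa [← e₁, ← e₂]
    · obtain ⟨e₁, -, e₂, -⟩ := hlv₂ a haN₁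
      rwa [← e₁, ← e₂]
  · intro x hx
    rcases Finset.mem_disjUnion.1 hx with hx | hx
    · have := (hlv₁ x hx).mem_nodeInv (hx₁ x hx)
      rwa [State.sub_sub _ (by simpa using hx)] at this
    · have := (hlv₂' x hx).mem_nodeInv (hx₂ x hx)
      rwa [State.sub_sub _ (by simpa using hx)] at this

theorem cell_of_mem_nodeInv {x : Addr} (h : s.sub {x} ∈ lv.nodeInv head N x) :
    s.g.fg.cell x = some ⟨lv.mark x, lv.next x, lv.key x⟩ := by
  rw [← (mem_nodeInv.1 h).1.2.2.1]
  exact (FlowGraph.restrict_cell _ rfl).symm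

/-- The node conjuncts tie the logical variables to the cells, so the contents do not depend on the
valuation. -/
theorem contents_eq_of_mem_inv {N' M : Finset Addr} (h : s ∈ lv.inv head C N' N) (hM : M ⊆ N') :
    lv.contents M = s.contents M := by
  obtain ⟨-, -, -, -, hx⟩ := mem_inv.1 h
  ext k
  simp only [contents, nodeContents, State.contents, Set.mem_iUnion, exists_prop,
    Set.mem_ofPred_eq]
  refine exists_congr fun x => and_congr_right fun hxM => ?_
  rw [cell_of_mem_nodeInv (hx x (hM hxM))]
  simp only [Option.some.injEq, exists_eq_left']
  cases lv.mark x <;> simp [eq_comm (a := k)]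

end LogVal

variable {head : GVar} {I : Set (EKey K) → Finset Addr → Finset Addr → Set (State Addr K GVar LVar)}
  {N₁ N₂ N : Finset Addr} {C : Set (EKey K)} {s : State Addr K GVar LVar}

theorem mem_disjUnion_of_mem_sep (hI : (∃ lv : LogVal Addr K, I = lv.inv head) ∨ I = closedInv head)
    (hN : Disjoint N₁ N₂) {C₁ C₂ : Set (EKey K)} (h : s ∈ I C₁ N₁ N ∗ I C₂ N₂ N) :
    s ∈ I (C₁ ∪ C₂) (N₁.disjUnion N₂ hN) N := by
  rcases hI with ⟨lv, rfl⟩ | rfl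
  · exact LogVal.mem_inv_merge hN h (fun _ _ => ⟨rfl, rfl, rfl, rfl, rfl⟩)
      fun _ _ => ⟨rfl, rfl, rfl, rfl, rfl⟩
  · obtain ⟨s₁, ⟨lv₁, h₁⟩, s₂, ⟨lv₂, h₂⟩, hs⟩ := h
    exact ⟨LogVal.merge N₁ lv₁ lv₂, LogVal.mem_inv_merge hN ⟨s₁, h₁, s₂, h₂, hs⟩
      (fun _ => LogVal.agreeAt_merge_left) fun _ => LogVal.agreeAt_merge_right⟩

theorem mem_sep_of_mem_disjUnion (hI : (∃ lv : LogVal Addr K, I = lv.inv head) ∨ I = closedInv head)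
    (hN : Disjoint N₁ N₂) (h : s ∈ I C (N₁.disjUnion N₂ hN) N) :
    C = s.contents N₁ ∪ s.contents N₂ ∧ s ∈ I (s.contents N₁) N₁ N ∗ I (s.contents N₂) N₂ N := by
  obtain ⟨lv, hlv, hsub⟩ : ∃ lv : LogVal Addr K, s ∈ lv.inv head C (N₁.disjUnion N₂ hN) N ∧
      ∀ C M, lv.inv head C M N ⊆ I C M N := by
    rcases hI with ⟨lv, rfl⟩ | rfl
    · exact ⟨lv, h, fun _ _ => subset_rfl⟩
    · obtain ⟨lv, h⟩ := h
      exact ⟨lv, h, fun _ _ _ h => ⟨lv, h⟩⟩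
  have := LogVal.mem_inv_disjUnion hN hlv
  rw [LogVal.contents_eq_of_mem_inv (M := N₁) hlv fun x hx => by simp [hx],
    LogVal.contents_eq_of_mem_inv (M := N₂) hlv fun x hx => by simp [hx]] at this
  obtain ⟨hC, s₁, h₁, s₂, h₂, hs⟩ := this
  exact ⟨hC, s₁, hsub _ _ h₁, s₂, hsub _ _ h₂, hs⟩

theorem decomposesAt_of_disjoint_contents
    (hI : (∃ lv : LogVal Addr K, I = lv.inv head) ∨ I = closedInv head) (hN : Disjoint N₁ N₂)
    (hd : Disjoint (s.contents N₁) (s.contents N₂)) : DecomposesAt I N₁ N₂ hN N s := by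
  intro C
  constructor
  · intro h
    obtain ⟨hC, h⟩ := mem_sep_of_mem_disjUnion hI hN h
    exact ⟨_, _, ⟨hC, hd⟩, h⟩
  · rintro ⟨C₁, C₂, ⟨rfl, -⟩, h⟩
    exact mem_disjUnion_of_mem_sep hI hN h

/-! ### Distinct keys of unmarked nodes in a complete structure -/

/-- A node of a complete structure other than the head node that has a non-empty flow is the
successor of a node with a non-empty inset and a smaller key. -/
theorem IsStructure.exists_pred {t : State Addr K GVar LVar} {lv : LogVal Addr K} {h x : Addr}
    (ht : ∀ x ∈ N, t.sub {x} ∈ lv.nodeInv head N x) (hn : t.g.fg.nodes = N)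
    (hin : ∀ y x, t.g.fg.inflow y x = ∅)
    (hbot : ∀ x c, t.g.fg.cell x = some c → c.key = ⊥ → t.g.stack head = Val.addr x)
    (hh : t.g.stack head = Val.addr h) (hhk : lv.key h = ⊥)
    (hx : x ∈ N) (hxh : x ≠ h) (hf : (lv.flow x).Nonempty) :
    ∃ y ∈ N, (lv.inset head t.g.stack y).Nonempty ∧ lv.next y = x ∧ lv.key y < lv.key x := by
  have hne : ∀ z ∈ N, z ≠ h → lv.key z ≠ ⊥ := fun z hz hzh hk => hzh <| Val.addr.inj <|
    (hbot z _ (LogVal.cell_of_mem_nodeInv (ht z hz)) hk).symm.trans hh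
  have hinset : ∀ z, z ≠ h → lv.inset head t.g.stack z = lv.flow z := fun z hzh =>
    if_neg fun e => hzh (Val.addr.inj (e.symm.trans hh))
  obtain ⟨⟨-, hxn, hxc, hxf, hxi⟩, -, h2, -, h4⟩ := LogVal.mem_nodeInv.1 (ht x hx)
  -- A self-loop at `x` creates no flow: as the key of `x` is not `-∞`, it only passes on keys that
  -- are already in the flow.
  have hsub : lv.flow x ⊆ ⋃ y, lv.inflow x y := by
    intro k hk
    rw [← hxf] at hk
    have := FlowGraph.flow_le (f := (t.sub {x}).g.fg) (F := fun _ => ⋃ y, lv.inflow x y) ?_ x hk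
    · exact this
    intro z hz k hk
    have hz : z = x := by rw [hxn] at hz; exact hz
    subst hz
    rcases hk with ⟨y, -, hk⟩ | ⟨y, c, hc, hk⟩
    · rw [hxi] at hk
      exact Set.mem_iUnion.2 ⟨y, hk⟩
    · have hy : y = z := by
        have := FlowGraph.mem_nodes_of_cell hc
        rw [hxn] at this; exact this
      subst hy
      rw [hxc] at hc
      obtain rfl := Option.some.inj hc
      obtain ⟨-, ⟨hk, -⟩ | ⟨-, hk⟩⟩ := hk
      · exact absurd hk (hne _ hx hxh)
      · exact hk.1
  obtain ⟨k, hk⟩ := hf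
  obtain ⟨y, hky⟩ := Set.mem_iUnion.1 (hsub hk)
  -- Without inflow from outside, the inflow of the one-node restriction consists of outflow of
  -- nodes.
  have hiy : ∀ k ∈ lv.inflow x y, k ∈ t.g.fg.out y x := by
    intro k hk
    rw [← hxi] at hk
    have := ((FlowGraph.mem_restrict_inflow _).1 hk).2.2.2
    rwa [hin, Set.mem_empty_iff_false, false_or] at this
  have hyN : y ∈ N := by
    by_contra hy
    have : k ∈ t.g.fg.out y x := hiy k hky
    rw [FlowGraph.out_eq_empty (by rw [hn]; simpa using hy)] at this
    exact this
  have hyf : t.g.fg.flow y = lv.flow y := by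
    rw [← (LogVal.mem_nodeInv.1 (ht y hyN)).1.2.2.2.1]
    exact (FlowGraph.flow_restrict t.g.fg (S := {y}) rfl).symm
  -- By condition 4, the whole flow of `x` comes from the single node `y`, so unless `y` is the
  -- head, every key in it exceeds the key of `y`.
  have hedge : ∀ k ∈ lv.flow x, lv.next y = x ∧ (y ≠ h → k ∈ lv.flow y ∧ lv.key y < k) := by
    intro k hk
    obtain ⟨z, hz⟩ := Set.mem_iUnion.1 (hsub hk)
    obtain rfl : y = z := h4 y z ⟨⟨_, hky⟩, ⟨_, hz⟩⟩
    obtain ⟨c, hc, hnx, hk⟩ := hiy k hz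
    rw [LogVal.cell_of_mem_nodeInv (ht y hyN)] at hc
    obtain rfl := Option.some.inj hc
    refine ⟨hnx, fun hyh => ?_⟩
    obtain ⟨hk, -⟩ | ⟨-, hk⟩ := hk
    · exact absurd hk (hne y hyN hyh)
    · exact ⟨hyf ▸ hk.1, not_le.1 hk.2⟩
  obtain ⟨hnx, hlt⟩ := hedge k hk
  by_cases hyh : y = h
  · subst hyh
    refine ⟨y, hyN, ?_, hnx, ?_⟩
    · rw [LogVal.inset, if_pos hh]
      exact Set.univ_nonempty
    · rw [hhk]
      exact bot_lt_iff_ne_bot.2 (hne x hx hxh)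
  · refine ⟨y, hyN, ?_, hnx, ?_⟩
    · rw [hinset y hyh]
      exact ⟨k, (hlt hyh).1⟩
    -- The interval in condition 2 contains the key of `x` only if this key is not `∞`. In that case
    -- the key itself came through `y`; otherwise any key that passed `y` suffices.
    · by_cases htop : lv.key x = ⊤
      · rw [htop]
        exact (hlt hyh).2.trans_le le_top
      · have hsub' := h2 (show (lv.inset head t.g.stack x).Nonempty from hinset x hxh ▸ ⟨k, hk⟩)
        have hkx := hsub' ⟨le_rfl, lt_top_iff_ne_top.2 htop⟩
        exact ((hedge _ (hinset x hxh ▸ hkx)).2 hyh).2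

theorem IsStructure.key_injective {t : State Addr K GVar LVar} (ht : IsStructure head N t)
    {x y : Addr} {c d : Cell Addr K} (hx : t.g.fg.cell x = some c) (hy : t.g.fg.cell y = some d)
    (hc : c.mark = false) (hd : d.mark = false) (hk : c.key = d.key) : x = y := by
  obtain ⟨⟨C, lv, hlv⟩, hin, hbot⟩ := ht
  obtain ⟨-, ⟨h, hhN, hh, hhk, -⟩, -, hn, hX⟩ := LogVal.mem_inv.1 hlv
  -- Well-founded induction on the keys of the finite set `N`, going back to a predecessor with
  -- smaller key until the head is reached.
  have hchain : ∀ x ∈ N, (lv.inset head t.g.stack x).Nonempty →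
      ∃ n, lv.next^[n] h = x ∧ ∀ i < n, lv.key (lv.next^[i] h) < lv.key (lv.next^[i + 1] h) := by
    have : IsStrictOrder Addr fun x y => lv.key x < lv.key y :=
      { irrefl := fun _ => lt_irrefl _, trans := fun _ _ _ => lt_trans }
    have hwf : (N : Set Addr).WellFoundedOn fun x y => lv.key x < lv.key y :=
      N.finite_toSet.wellFoundedOn
    intro x hx
    refine hwf.induction (P := fun x => (lv.inset head t.g.stack x).Nonempty →
      ∃ n, lv.next^[n] h = x ∧ ∀ i < n, lv.key (lv.next^[i] h) < lv.key (lv.next^[i + 1] h))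
      (Finset.mem_coe.2 hx) fun x hx ih hne => ?_
    by_cases hxh : x = h
    · exact ⟨0, hxh.symm, by simp⟩
    rw [LogVal.inset, if_neg fun e => hxh (Val.addr.inj (e.symm.trans hh))] at hne
    obtain ⟨y, hy, hyne, rfl, hlt⟩ := exists_pred hX hn hin hbot hh hhk hx hxh hne
    obtain ⟨n, rfl, hn⟩ := ih y hy hlt hyne
    refine ⟨n + 1, Function.iterate_succ_apply' _ _ _, fun i hi => ?_⟩
    rcases Nat.lt_succ_iff_lt_or_eq.1 hi with hi | rfl
    · exact hn i hi
    · rwa [Function.iterate_succ_apply']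
  have hact : ∀ {x c}, t.g.fg.cell x = some c → c.mark = false → c.key = lv.key x ∧
      ∃ n, lv.next^[n] h = x ∧ ∀ i < n, lv.key (lv.next^[i] h) < lv.key (lv.next^[i + 1] h) := by
    intro x c hx hc
    have hxN : x ∈ N := by
      have := FlowGraph.mem_nodes_of_cell hx
      rwa [hn] at this
    have hx' := LogVal.cell_of_mem_nodeInv (hX x hxN)
    rw [hx] at hx'
    obtain rfl := Option.some.inj hx'
    exact ⟨rfl, hchain x hxN ((LogVal.mem_nodeInv.1 (hX x hxN)).2.1 hc)⟩
  obtain ⟨ex, n, hn, hnlt⟩ := hact hx hc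
  obtain ⟨ey, m, hm, hmlt⟩ := hact hy hd
  have hmono : ∀ m, (∀ i < m, lv.key (lv.next^[i] h) < lv.key (lv.next^[i + 1] h)) →
      ∀ n < m, lv.key (lv.next^[n] h) < lv.key (lv.next^[m] h) := by
    intro m hm n hnm
    induction m with
    | zero => simp at hnm
    | succ m ih =>
      rcases Nat.lt_succ_iff_lt_or_eq.1 hnm with hlt | rfl
      · exact (ih (fun i hi => hm i (hi.trans m.lt_succ_self)) hlt).trans (hm m m.lt_succ_self)
      · exact hm n n.lt_succ_self
  rw [ex, ey, ← hn, ← hm] at hk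
  -- Both nodes are iterates of `next` from the head; different numbers of steps would give
  -- different keys on the longer chain.
  rcases lt_trichotomy n m with hlt | rfl | hlt
  · exact absurd hk (hmono m hmlt n hlt).ne
  · exact hn.symm.trans hm
  · exact absurd hk (hmono n hnlt m hlt).ne'

theorem disjoint_contents_of_isStructure {f t : State Addr K GVar LVar} (hN : Disjoint N₁ N₂)
    (hs : IsComp s f t) (ht : IsStructure head N t) :
    Disjoint (s.contents N₁) (s.contents N₂) := by
  have hcell : ∀ {x c}, s.g.fg.cell x = some c → t.g.fg.cell x = some c := by
    intro x c hx
    rw [hs.1.2.1]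
    show (s.g.fg.cell x).or _ = _
    rw [hx]
    rfl
  rw [Set.disjoint_left]
  rintro k ⟨x, hx, c, hxc, hc, rfl⟩ ⟨y, hy, d, hyd, hd, hk⟩
  obtain rfl := ht.key_injective (hcell hxc) (hcell hyd) hc hd hk.symm
  exact Finset.disjoint_left.1 hN hx hy

end Decomposition

end HarrisSet

theorem mainTheorem6 {Addr K GVar LVar : Type*} [LinearOrder K] (head : GVar)
    (I : Set (EKey K) → Finset Addr → Finset Addr → Set (State Addr K GVar LVar))
    (hI : (∃ lv : LogVal Addr K, I = lv.inv head) ∨ I = closedInv head)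
    (N₁ N₂ : Finset Addr) (hN : Disjoint N₁ N₂) (N : Finset Addr)
    (s : State Addr K GVar LVar) :
    (Disjoint (s.contents N₁) (s.contents N₂) → DecomposesAt I N₁ N₂ hN N s) ∧
    ((∃ f t : State Addr K GVar LVar, IsComp s f t ∧ IsStructure head N t) →
      DecomposesAt I N₁ N₂ hN N s) ∧
    (∀ C, s ∈ I C (N₁.disjUnion N₂ hN) N ↔
      ∃ C₁ C₂, C = C₁ ∪ C₂ ∧ s ∈ I C₁ N₁ N ∗ I C₂ N₂ N) := by
  refine ⟨decomposesAt_of_disjoint_contents hI hN, ?_, fun C => ⟨fun h => ?_, ?_⟩⟩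
  · rintro ⟨f, t, hs, ht⟩
    exact decomposesAt_of_disjoint_contents hI hN (disjoint_contents_of_isStructure hN hs ht)
  · exact ⟨_, _, mem_sep_of_mem_disjUnion hI hN h⟩
  · rintro ⟨C₁, C₂, rfl, h⟩
    exact mem_disjUnion_of_mem_sep hI hN h
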